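/- Let $M$ be a closed (compact, without boundary) connected smooth manifold of dimension $n$ and let $g$ be a smooth pseudo-Riemannian metric on $M$ of indefinite signature, i.e. for no constant $c$ is the metric $c\cdot g$ Riemannian. Suppose that $g$ is light-line-complete: every light-line geodesic (an affinely parametrized geodesic $\gamma$ of $g$ with $\dot\gamma\neq 0$ and $g(\dot\gamma,\dot\gamma)=0$) extends to a geodesic defined on all of $\mathbb{R}$. Let $\nabla$ be the Levi-Civita connection of $g$. Then every function $\lambda\colon M\to\mathbb{R}$ of class $C^3$ satisfying $$\nabla_k\nabla_j\nabla_i\lambda+2\,\nabla_k\lambda\cdot g_{ij}+\nabla_i\lambda\cdot g_{jk}+\nabla_j\lambda\cdot g_{ik}=0$$ on $M$ is constant. -/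

import Mathlib

open Bundle Manifold
open scoped ContDiff Topology

noncomputable section

namespace PseudoRiem

variable {n : ℕ} {M : Type*} [TopologicalSpace M] [ChartedSpace (EuclideanSpace ℝ (Fin n)) M]

/-- A smooth pseudo-Riemannian metric on the smooth `n`-manifold `M`: a smooth section of the bundle
of bilinear forms on the tangent spaces that is symmetric and nondegenerate at every point. -/
structure Metric (n : ℕ) (M : Type*) [TopologicalSpace M]
    [ChartedSpace (EuclideanSpace ℝ (Fin n)) M] [IsManifold (𝓡 n) ∞ M] where
  /-- The bilinear form on each tangent space. -/
  form (x : M) : TangentSpace (𝓡 n) x →L[ℝ] TangentSpace (𝓡 n) x →L[ℝ] ℝ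
  symm (x : M) (v w : TangentSpace (𝓡 n) x) : form x v w = form x w v
  nondegenerate (x : M) (v : TangentSpace (𝓡 n) x) : (∀ w, form x v w = 0) → v = 0
  smooth : ContMDiff (𝓡 n)
    ((𝓡 n).prod 𝓘(ℝ, EuclideanSpace ℝ (Fin n) →L[ℝ] EuclideanSpace ℝ (Fin n) →L[ℝ] ℝ)) ∞
    (fun x ↦ TotalSpace.mk' (EuclideanSpace ℝ (Fin n) →L[ℝ] EuclideanSpace ℝ (Fin n) →L[ℝ] ℝ)
      (E := fun x : M ↦ TangentSpace (𝓡 n) x →L[ℝ] TangentSpace (𝓡 n) x →L[ℝ] ℝ) x (form x))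

/-- The `i`-th partial derivative `∂_i f` at `y` of a function `f` of the coordinates. -/
def pd (i : Fin n) (f : EuclideanSpace ℝ (Fin n) → ℝ) (y : EuclideanSpace ℝ (Fin n)) : ℝ :=
  fderiv ℝ f y (EuclideanSpace.single i 1)

/-- The coordinate vector `∂/∂x_i` of the chart `φ`, at the point with coordinates `y`. -/
def coordVec (φ : OpenPartialHomeomorph M (EuclideanSpace ℝ (Fin n)))
    (y : EuclideanSpace ℝ (Fin n)) (i : Fin n) : TangentSpace (𝓡 n) (φ.symm y) :=
  mfderiv (𝓡 n) (𝓡 n) φ.symm y (EuclideanSpace.single i 1 : EuclideanSpace ℝ (Fin n))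

/-- The velocity vector of a curve. -/
def velocity (γ : ℝ → M) (t : ℝ) : TangentSpace (𝓡 n) (γ t) :=
  mfderiv 𝓘(ℝ, ℝ) (𝓡 n) γ t (1 : ℝ)

namespace Metric

variable [IsManifold (𝓡 n) ∞ M] (g : Metric n M)
  (φ : OpenPartialHomeomorph M (EuclideanSpace ℝ (Fin n)))

/-- For no constant `c` is the metric `c • g` Riemannian. -/
def IsIndefinite : Prop :=
  ∀ c : ℝ, ¬ ∀ (x : M) (v : TangentSpace (𝓡 n) x), v ≠ 0 → 0 < c * g.form x v v

/-- The matrix `(g_ij)` of the metric in the chart `φ`, as a function of the coordinates. -/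
def comp (y : EuclideanSpace ℝ (Fin n)) : Matrix (Fin n) (Fin n) ℝ :=
  Matrix.of fun i j ↦ g.form (φ.symm y) (coordVec φ y i) (coordVec φ y j)

/-- The Christoffel symbol
`Γ^k_ij = 1/2 ∑_l g^{kl} (∂_i g_jl + ∂_j g_il - ∂_l g_ij)` of the Levi-Civita connection of `g`
in the chart `φ`, as a function of the coordinates. -/
def christoffel (k i j : Fin n) (y : EuclideanSpace ℝ (Fin n)) : ℝ :=
  (1 / 2) * ∑ l, (g.comp φ y)⁻¹ k l *
    (pd i (fun z ↦ g.comp φ z j l) y + pd j (fun z ↦ g.comp φ z i l) y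
      - pd l (fun z ↦ g.comp φ z i j) y)

/-- `∇_i f` in the chart `φ`. -/
def nabla₁ (f : M → ℝ) (i : Fin n) (y : EuclideanSpace ℝ (Fin n)) : ℝ :=
  pd i (fun z ↦ f (φ.symm z)) y

/-- `∇_j ∇_i f = ∂_j ∇_i f - ∑_l Γ^l_ji ∇_l f` in the chart `φ`. -/
def nabla₂ (f : M → ℝ) (j i : Fin n) (y : EuclideanSpace ℝ (Fin n)) : ℝ :=
  pd j (nabla₁ φ f i) y - ∑ l, g.christoffel φ l j i y * nabla₁ φ f l y

/-- `∇_k ∇_j ∇_i f = ∂_k ∇_j ∇_i f - ∑_l Γ^l_kj ∇_l ∇_i f - ∑_l Γ^l_ki ∇_j ∇_l f`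
in the chart `φ`. -/
def nabla₃ (f : M → ℝ) (k j i : Fin n) (y : EuclideanSpace ℝ (Fin n)) : ℝ :=
  pd k (g.nabla₂ φ f j i) y - ∑ l, g.christoffel φ l k j y * g.nabla₂ φ f l i y
    - ∑ l, g.christoffel φ l k i y * g.nabla₂ φ f j l y

/-- The function `f` is a solution of the Gallot-Tanno equation: it is of class `C^3`, and
`∇_k ∇_j ∇_i f + 2 ∇_k f g_ij + ∇_i f g_jk + ∇_j f g_ik = 0` in all local coordinates. -/
def IsGallotTannoSolution (f : M → ℝ) : Prop :=
  ContMDiff (𝓡 n) 𝓘(ℝ, ℝ) 3 f ∧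
  ∀ φ ∈ IsManifold.maximalAtlas (𝓡 n) ∞ M, ∀ y ∈ φ.target, ∀ i j k : Fin n,
    g.nabla₃ φ f k j i y + 2 * nabla₁ φ f k y * g.comp φ y i j
      + nabla₁ φ f i y * g.comp φ y j k + nabla₁ φ f j y * g.comp φ y i k = 0

/-- The curve `γ` is an (affinely parametrized) geodesic of `g` on the open set `J` of parameters:
it is of class `C^2` on `J`, and around each parameter in `J` it satisfies
`(x^k)'' + ∑_ij Γ^k_ij (x^i)' (x^j)' = 0` in some local coordinates `x = φ ∘ γ`
(the validity of this equation does not depend on the choice of coordinates). -/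
def IsGeodesicOn (γ : ℝ → M) (J : Set ℝ) : Prop :=
  ContMDiffOn 𝓘(ℝ, ℝ) (𝓡 n) 2 γ J ∧
  ∀ t₀ ∈ J, ∃ φ ∈ IsManifold.maximalAtlas (𝓡 n) ∞ M, γ t₀ ∈ φ.source ∧
    ∀ᶠ t in 𝓝 t₀, ∀ k : Fin n,
      deriv (deriv fun s ↦ φ (γ s) k) t + ∑ i, ∑ j, g.christoffel φ k i j (φ (γ t)) *
        deriv (fun s ↦ φ (γ s) i) t * deriv (fun s ↦ φ (γ s) j) t = 0

/-- A light-line (null) geodesic: its velocity is a nonzero null vector everywhere. -/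
def IsLightLineGeodesicOn (γ : ℝ → M) (J : Set ℝ) : Prop :=
  g.IsGeodesicOn γ J ∧
  ∀ t ∈ J, velocity (n := n) γ t ≠ 0 ∧
    g.form (γ t) (velocity (n := n) γ t) (velocity (n := n) γ t) = 0

/-- The metric is light-line-complete: every light-line geodesic, defined on a nonempty open
interval, extends to a geodesic defined on the whole of `ℝ`. -/
def IsLightLineComplete : Prop :=
  ∀ (γ : ℝ → M) (J : Set ℝ), IsOpen J → J.OrdConnected → J.Nonempty →
    g.IsLightLineGeodesicOn γ J →
    ∃ γ' : ℝ → M, g.IsGeodesicOn γ' Set.univ ∧ Set.EqOn γ' γ J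

end Metric

end PseudoRiem

end

/-!
Let `f` be a solution of the Gallot–Tanno equation and `h = f ∘ γ` its restriction to a geodesic
`γ`. Contracting the equation with three copies of the velocity gives `h''' = -4 g(γ', γ') h'`
(`IsGallotTannoSolution.hasDerivAt_comp_geodesic`). The energy `g(γ', γ')` of a geodesic is constant
(`IsGeodesicOn.hasDerivAt_energy`), so along a null geodesic `h''' = 0`. If the null geodesic is
complete, then `h` is a quadratic polynomial on the whole line, and it is bounded because the
manifold is compact; hence `h' = 0`. As null geodesics exist in all null directions, by the
Picard–Lindelöf theorem in a chart (`exists_isChartGeodesicAt`), the differential of `f` kills all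
null vectors (`IsGallotTannoSolution.fderiv_apply_eq_zero`).

Since the manifold is connected and the metric nondegenerate, a metric that is not definite
everywhere takes both signs on every tangent space (`IsIndefinite.exists_mul_neg`). The null vectors
of an indefinite form span (`eq_zero_of_vanish_on_null`), so the differential of `f` vanishes and
`f` is locally constant, hence constant.

All computations take place in a chart `φ`, with `φ.symm` as the parametrization of the manifold and
curves given by their coordinates `x` and coordinate velocity `v`.
-/

namespace PseudoRiem

/-! ### The metric and its Christoffel symbols in a chart -/

section Chart

variable {n : ℕ} {M : Type*} [TopologicalSpace M] [ChartedSpace (EuclideanSpace ℝ (Fin n)) M]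
  {φ : OpenPartialHomeomorph M (EuclideanSpace ℝ (Fin n))}
  {y : EuclideanSpace ℝ (Fin n)}

theorem mdifferentiableAt_chart_symm (hφ : φ ∈ IsManifold.maximalAtlas (𝓡 n) ∞ M)
    (hy : y ∈ φ.target) : MDifferentiableAt (𝓡 n) (𝓡 n) φ.symm y :=
  (contMDiffAt_symm_of_mem_maximalAtlas hφ hy).mdifferentiableAt (by simp)

theorem mdifferentiableAt_chart (hφ : φ ∈ IsManifold.maximalAtlas (𝓡 n) ∞ M) {x : M}
    (hx : x ∈ φ.source) : MDifferentiableAt (𝓡 n) (𝓡 n) φ x :=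
  (contMDiffAt_of_mem_maximalAtlas hφ hx).mdifferentiableAt (by simp)

theorem contDiffOn_comp_chart_symm {f : M → ℝ}
    (hf : ContMDiff (𝓡 n) 𝓘(ℝ, ℝ) 3 f) (hφ : φ ∈ IsManifold.maximalAtlas (𝓡 n) ∞ M) :
    ContDiffOn ℝ 3 (fun z ↦ f (φ.symm z)) φ.target := by
  rw [← contMDiffOn_iff_contDiffOn]
  exact hf.comp_contMDiffOn ((contMDiffOn_symm_of_mem_maximalAtlas hφ).of_le
    ENat.LEInfty.out)

theorem mfderiv_chart_symm_injective (hφ : φ ∈ IsManifold.maximalAtlas (𝓡 n) ∞ M)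
    (hy : y ∈ φ.target) : Function.Injective (mfderiv (𝓡 n) (𝓡 n) φ.symm y) := by
  have h := mfderiv_comp y (mdifferentiableAt_chart hφ (φ.map_target hy))
    (mdifferentiableAt_chart_symm hφ hy)
  have h2 : mfderiv (𝓡 n) (𝓡 n) (φ ∘ φ.symm) y
      = mfderiv (𝓡 n) (𝓡 n) (id : EuclideanSpace ℝ (Fin n) → _) y := by
    apply Filter.EventuallyEq.mfderiv_eq
    filter_upwards [φ.open_target.mem_nhds hy] with z hz using φ.right_inv hz
  rw [h2, mfderiv_id] at h
  refine Function.LeftInverse.injective (g := mfderiv (𝓡 n) (𝓡 n) φ (φ.symm y)) fun u ↦ ?_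
  exact (DFunLike.congr_fun h u).symm

theorem mfderiv_chart_symm_surjective (hφ : φ ∈ IsManifold.maximalAtlas (𝓡 n) ∞ M)
    (hy : y ∈ φ.target) : Function.Surjective (mfderiv (𝓡 n) (𝓡 n) φ.symm y) :=
  let D : EuclideanSpace ℝ (Fin n) →L[ℝ] EuclideanSpace ℝ (Fin n) :=
    mfderiv (𝓡 n) (𝓡 n) φ.symm y
  D.toLinearMap.surjective_of_injective (mfderiv_chart_symm_injective hφ hy)

theorem sum_smul_single (u : EuclideanSpace ℝ (Fin n)) :
    u = ∑ i, u i • (EuclideanSpace.single i 1 : EuclideanSpace ℝ (Fin n)) := by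
  ext j
  simp [Pi.single_apply]

theorem fderiv_apply_eq_sum_pd (f : EuclideanSpace ℝ (Fin n) → ℝ)
    (u : EuclideanSpace ℝ (Fin n)) : fderiv ℝ f y u = ∑ i, pd i f y * u i := by
  conv_lhs => rw [sum_smul_single u]
  simp [pd, mul_comm]

/-- Partial derivatives lower the differentiability class by one. -/
theorem contDiffOn_pd {f : EuclideanSpace ℝ (Fin n) → ℝ} {s : Set (EuclideanSpace ℝ (Fin n))}
    (hs : IsOpen s) {p q : ℕ∞ω} (hf : ContDiffOn ℝ q f s) (hpq : p + 1 ≤ q) (i : Fin n) :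
    ContDiffOn ℝ p (pd i f) s :=
  (hf.fderiv_of_isOpen hs hpq).clm_apply contDiffOn_const

namespace Metric

variable [IsManifold (𝓡 n) ∞ M] (g : Metric n M)

/-- The differential of the parametrization `φ.symm` at `y` identifies the model space with the
tangent space, and turns the metric into the form with matrix `g.comp φ y`. -/
theorem form_mfderiv_chart_symm (u w : EuclideanSpace ℝ (Fin n)) :
    g.form (φ.symm y) (mfderiv (𝓡 n) (𝓡 n) φ.symm y u) (mfderiv (𝓡 n) (𝓡 n) φ.symm y w)
      = ∑ i, ∑ j, g.comp φ y i j * u i * w j := by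
  let D : EuclideanSpace ℝ (Fin n) →L[ℝ] EuclideanSpace ℝ (Fin n) :=
    mfderiv (𝓡 n) (𝓡 n) φ.symm y
  let B : EuclideanSpace ℝ (Fin n) →L[ℝ] EuclideanSpace ℝ (Fin n) →L[ℝ] ℝ := g.form (φ.symm y)
  have key : B (D u) (D w) = ∑ i, ∑ j, B (D (EuclideanSpace.single i 1))
      (D (EuclideanSpace.single j 1)) * u i * w j := by
    conv_lhs => rw [sum_smul_single u, sum_smul_single w]
    simp only [map_sum, map_smul, sum_apply, smul_apply, smul_eq_mul, Finset.mul_sum]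
    rw [Finset.sum_comm]
    exact Finset.sum_congr rfl fun i _ ↦ Finset.sum_congr rfl fun j _ ↦ by ring
  exact key

theorem comp_symm (i j : Fin n) : g.comp φ y i j = g.comp φ y j i := g.symm _ _ _

/-- The matrix of the metric is invertible, so that the matrix inverse in the Christoffel symbols is
a genuine one. -/
theorem isUnit_det_comp (hφ : φ ∈ IsManifold.maximalAtlas (𝓡 n) ∞ M) (hy : y ∈ φ.target) :
    IsUnit (g.comp φ y).det := by
  rw [isUnit_iff_ne_zero]
  intro h0
  obtain ⟨c, hc, hc0⟩ := Matrix.exists_mulVec_eq_zero_iff.2 h0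
  apply hc
  let u : EuclideanSpace ℝ (Fin n) := WithLp.toLp 2 c
  have : mfderiv (𝓡 n) (𝓡 n) φ.symm y u = 0 := by
    apply g.nondegenerate
    intro w
    obtain ⟨(w : EuclideanSpace ℝ (Fin n)), rfl⟩ := mfderiv_chart_symm_surjective hφ hy w
    rw [g.symm]
    refine (g.form_mfderiv_chart_symm w u).trans (Finset.sum_eq_zero fun i _ ↦ ?_)
    have hi : ∑ j, g.comp φ y i j * c j = 0 := congrFun hc0 i
    calc ∑ j, g.comp φ y i j * w i * u j = w i * ∑ j, g.comp φ y i j * c j := by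
          rw [Finset.mul_sum]
          exact Finset.sum_congr rfl fun j _ ↦ by ring
      _ = 0 := by rw [hi, mul_zero]
  have hu : u = 0 := mfderiv_chart_symm_injective hφ hy (this.trans (map_zero _).symm)
  ext i
  exact congrArg (fun v : EuclideanSpace ℝ (Fin n) ↦ v i) hu

theorem contMDiffOn_coordVec (hφ : φ ∈ IsManifold.maximalAtlas (𝓡 n) ∞ M) (i : Fin n) :
    ContMDiffOn (𝓡 n) ((𝓡 n).prod (𝓡 n)) ∞
      (fun z ↦ TotalSpace.mk' (EuclideanSpace ℝ (Fin n)) (E := fun x : M ↦ TangentSpace (𝓡 n) x)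
        (φ.symm z) (coordVec φ z i)) φ.target := by
  have h := (contMDiffOn_symm_of_mem_maximalAtlas hφ).contMDiffOn_tangentMapWithin
    (m := ∞) (by simp) φ.open_target.uniqueMDiffOn
  have hs : ContMDiff (𝓡 n) ((𝓡 n).prod (𝓡 n)) ∞
      (fun z : EuclideanSpace ℝ (Fin n) ↦ TotalSpace.mk' (EuclideanSpace ℝ (Fin n))
        (E := fun x ↦ TangentSpace (𝓡 n) x) z (EuclideanSpace.single i (1 : ℝ))) := by
    intro z
    refine (contMDiffAt_section (E := fun x : EuclideanSpace ℝ (Fin n) ↦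
      TangentSpace (𝓡 n) x) (s := fun _ ↦ EuclideanSpace.single i (1 : ℝ)) z).2 ?_
    simpa using contMDiffAt_const
  have h2 := h.comp hs.contMDiffOn (s := φ.target) (fun z hz ↦ hz)
  refine h2.congr fun z hz ↦ ?_
  simp only [Function.comp, tangentMapWithin, coordVec]
  rw [mfderivWithin_of_isOpen φ.open_target hz]

theorem contDiffOn_comp (hφ : φ ∈ IsManifold.maximalAtlas (𝓡 n) ∞ M) (i j : Fin n) :
    ContDiffOn ℝ ∞ (fun z ↦ g.comp φ z i j) φ.target := by
  rw [← contMDiffOn_iff_contDiffOn]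
  intro z hz
  have h : ContMDiffWithinAt (𝓡 n) ((𝓡 n).prod 𝓘(ℝ)) ∞
      (fun m ↦ TotalSpace.mk' ℝ (E := Bundle.Trivial M ℝ) (φ.symm m)
        (g.form (φ.symm m) (coordVec φ m i) (coordVec φ m j))) φ.target z := by
    apply ContMDiffWithinAt.clm_bundle_apply₂ (F₁ := EuclideanSpace ℝ (Fin n))
      (F₂ := EuclideanSpace ℝ (Fin n))
    · exact ContMDiffAt.comp_contMDiffWithinAt z g.smooth.contMDiffAt
        (contMDiffOn_symm_of_mem_maximalAtlas hφ z hz)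
    · exact contMDiffOn_coordVec hφ i z hz
    · exact contMDiffOn_coordVec hφ j z hz
  simp only [contMDiffWithinAt_totalSpace] at h
  exact h.2

theorem contDiffOn_christoffel (hφ : φ ∈ IsManifold.maximalAtlas (𝓡 n) ∞ M) (k i j : Fin n) :
    ContDiffOn ℝ ∞ (g.christoffel φ k i j) φ.target := by
  have hpd (a b c : Fin n) : ContDiffOn ℝ ∞ (pd a fun z ↦ g.comp φ z b c) φ.target :=
    contDiffOn_pd φ.open_target (g.contDiffOn_comp hφ b c) (by simp) a
  have hdet {A : EuclideanSpace ℝ (Fin n) → Matrix (Fin n) (Fin n) ℝ}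
      (hA : ∀ a b, ContDiffOn ℝ ∞ (fun z ↦ A z a b) φ.target) :
      ContDiffOn ℝ ∞ (fun z ↦ (A z).det) φ.target := by
    simp only [Matrix.det_apply]
    refine ContDiffOn.sum fun σ _ ↦ ContDiffOn.const_smul _ (contDiffOn_prod fun a _ ↦ hA _ _)
  have hinv (a b : Fin n) : ContDiffOn ℝ ∞ (fun z ↦ (g.comp φ z)⁻¹ a b) φ.target := by
    simp only [Matrix.inv_def, Matrix.smul_apply, Ring.inverse_eq_inv', smul_eq_mul,
      Matrix.adjugate_apply]
    refine ((hdet fun c d ↦ g.contDiffOn_comp hφ c d).inv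
      fun z hz ↦ (g.isUnit_det_comp hφ hz).ne_zero).mul (hdet fun c d ↦ ?_)
    by_cases hc : c = b
    · subst hc
      simpa using contDiffOn_const
    · simpa [Matrix.updateRow_ne hc] using g.contDiffOn_comp hφ c d
  exact contDiffOn_const.mul (ContDiffOn.sum fun l _ ↦
    (hinv k l).mul (((hpd i j l).add (hpd j i l)).sub (hpd l i j)))

/-- Lowering the upper index of the Christoffel symbols gives the symbols of the first kind. -/
theorem sum_comp_mul_christoffel (hφ : φ ∈ IsManifold.maximalAtlas (𝓡 n) ∞ M)
    (hy : y ∈ φ.target) (m i j : Fin n) :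
    ∑ k, g.comp φ y m k * g.christoffel φ k i j y
      = (1 / 2) * (pd i (fun z ↦ g.comp φ z j m) y + pd j (fun z ↦ g.comp φ z i m) y
          - pd m (fun z ↦ g.comp φ z i j) y) := by
  -- Up to the factor `1 / 2`, the symbols of the first kind form a vector `c`, which `christoffel`
  -- multiplies by the inverse matrix of the metric.
  let c : Fin n → ℝ := fun l ↦ pd i (fun z ↦ g.comp φ z j l) y + pd j (fun z ↦ g.comp φ z i l) y
      - pd l (fun z ↦ g.comp φ z i j) y
  have h1 (k : Fin n) :
      g.christoffel φ k i j y = (1 / 2) * ((g.comp φ y)⁻¹.mulVec c) k := rfl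
  have h2 : (g.comp φ y).mulVec ((g.comp φ y)⁻¹.mulVec c) m = c m := by
    rw [Matrix.mulVec_mulVec, Matrix.mul_nonsing_inv _ (g.isUnit_det_comp hφ hy),
      Matrix.one_mulVec]
  change _ = (1 / 2) * c m
  rw [← h2]
  simp only [h1]
  rw [Matrix.mulVec, dotProduct, Finset.mul_sum]
  exact Finset.sum_congr rfl fun k _ ↦ by ring

end Metric

end Chart

/-! ### Functions along geodesics -/

theorem Metric.contDiffOn_nabla₁ {n : ℕ} {M : Type*} [TopologicalSpace M]
    {φ : OpenPartialHomeomorph M (EuclideanSpace ℝ (Fin n))} {f : M → ℝ}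
    (hf : ContDiffOn ℝ 3 (fun z ↦ f (φ.symm z)) φ.target) (i : Fin n) :
    ContDiffOn ℝ 2 (nabla₁ φ f i) φ.target :=
  contDiffOn_pd φ.open_target hf (by norm_num) i

section Curves

variable {n : ℕ} {M : Type*} [TopologicalSpace M] [ChartedSpace (EuclideanSpace ℝ (Fin n)) M]
  {φ : OpenPartialHomeomorph M (EuclideanSpace ℝ (Fin n))}

theorem hasDerivAt_apply {x : ℝ → EuclideanSpace ℝ (Fin n)} {x' : EuclideanSpace ℝ (Fin n)}
    {t : ℝ} (hx : HasDerivAt x x' t) (i : Fin n) : HasDerivAt (fun s ↦ x s i) (x' i) t :=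
  (EuclideanSpace.proj i : EuclideanSpace ℝ (Fin n) →L[ℝ] ℝ).hasFDerivAt.comp_hasDerivAt t hx

theorem hasDerivAt_comp_sum_pd {f : EuclideanSpace ℝ (Fin n) → ℝ}
    {x : ℝ → EuclideanSpace ℝ (Fin n)} {x' : EuclideanSpace ℝ (Fin n)} {t : ℝ}
    (hf : DifferentiableAt ℝ f (x t)) (hx : HasDerivAt x x' t) :
    HasDerivAt (fun s ↦ f (x s)) (∑ i, pd i f (x t) * x' i) t := by
  rw [← fderiv_apply_eq_sum_pd]
  exact hf.hasFDerivAt.comp_hasDerivAt t hx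

/-- The velocity of a curve, in terms of the velocity of its coordinate expression. The identity is
between vectors of the model space, in which all tangent spaces live. -/
theorem velocity_eq_mfderiv_chart_symm [IsManifold (𝓡 n) ∞ M] {γ : ℝ → M} {t : ℝ}
    {x : ℝ → EuclideanSpace ℝ (Fin n)} {x' : EuclideanSpace ℝ (Fin n)}
    (hφ : φ ∈ IsManifold.maximalAtlas (𝓡 n) ∞ M) (hxt : x t ∈ φ.target)
    (hγ : γ =ᶠ[𝓝 t] fun s ↦ φ.symm (x s)) (hx : HasDerivAt x x' t) :
    (velocity (n := n) γ t : EuclideanSpace ℝ (Fin n))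
      = mfderiv (𝓡 n) (𝓡 n) φ.symm (x t) x' := by
  have h1 : (mfderiv 𝓘(ℝ, ℝ) (𝓡 n) γ t : ℝ →L[ℝ] EuclideanSpace ℝ (Fin n))
      = mfderiv 𝓘(ℝ, ℝ) (𝓡 n) (φ.symm ∘ x) t := hγ.mfderiv_eq
  have hxd : MDifferentiableAt 𝓘(ℝ, ℝ) (𝓡 n) x t :=
    hx.differentiableAt.mdifferentiableAt
  have h2 := mfderiv_comp t (mdifferentiableAt_chart_symm hφ hxt) hxd
  have h3 : (mfderiv 𝓘(ℝ, ℝ) (𝓡 n) x t : ℝ →L[ℝ] EuclideanSpace ℝ (Fin n)) 1 = x' := by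
    rw [mfderiv_eq_fderiv]
    rw [hx.hasFDerivAt.fderiv]
    exact one_smul ℝ x'
  have h4 : (velocity (n := n) γ t : EuclideanSpace ℝ (Fin n))
      = (mfderiv 𝓘(ℝ, ℝ) (𝓡 n) (φ.symm ∘ x) t : ℝ →L[ℝ] EuclideanSpace ℝ (Fin n)) 1 :=
    congrArg (fun L : ℝ →L[ℝ] EuclideanSpace ℝ (Fin n) ↦ L 1) h1
  rw [h4, h2]
  exact congrArg (mfderiv (𝓡 n) (𝓡 n) φ.symm (x t)) h3

namespace Metric

variable [IsManifold (𝓡 n) ∞ M] (g : Metric n M)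
  (φ : OpenPartialHomeomorph M (EuclideanSpace ℝ (Fin n)))

/-- The coordinate acceleration `-Γ^k_ij(y) v^i v^j` of a geodesic in the chart `φ` that passes
through the point with coordinates `y` with coordinate velocity `v`. -/
noncomputable def acceleration (y v : EuclideanSpace ℝ (Fin n)) : EuclideanSpace ℝ (Fin n) :=
  WithLp.toLp 2 fun k ↦ -∑ i, ∑ j, g.christoffel φ k i j y * v i * v j

/-- The curve `x` of coordinates solves the geodesic equation in the chart `φ` at the parameter `t`,
written as a first-order system with velocity `v`. -/
structure IsChartGeodesicAt (x v : ℝ → EuclideanSpace ℝ (Fin n)) (t : ℝ) : Prop where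
  mem : x t ∈ φ.target
  hasDerivAt : HasDerivAt x (v t) t
  hasDerivAt_velocity : HasDerivAt v (g.acceleration φ (x t) (v t)) t

/-- The quantity `g(γ', γ')` along a curve `γ`. -/
noncomputable def energy (γ : ℝ → M) (t : ℝ) : ℝ :=
  g.form (γ t) (velocity (n := n) γ t) (velocity (n := n) γ t)

variable {g φ}

theorem energy_eq_sum {γ : ℝ → M} {t : ℝ} {x : ℝ → EuclideanSpace ℝ (Fin n)}
    {x' : EuclideanSpace ℝ (Fin n)} (hφ : φ ∈ IsManifold.maximalAtlas (𝓡 n) ∞ M)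
    (hxt : x t ∈ φ.target) (hγ : γ =ᶠ[𝓝 t] fun s ↦ φ.symm (x s)) (hx : HasDerivAt x x' t) :
    g.energy γ t = ∑ i, ∑ j, g.comp φ (x t) i j * x' i * x' j := by
  let B : M → EuclideanSpace ℝ (Fin n) →L[ℝ] EuclideanSpace ℝ (Fin n) →L[ℝ] ℝ := g.form
  have h1 : g.energy γ t = B (γ t) (velocity (n := n) γ t) (velocity (n := n) γ t) := rfl
  rw [h1, velocity_eq_mfderiv_chart_symm hφ hxt hγ hx, hγ.eq_of_nhds]
  exact g.form_mfderiv_chart_symm x' x'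

variable {f : M → ℝ}

theorem contDiffOn_nabla₂ (hφ : φ ∈ IsManifold.maximalAtlas (𝓡 n) ∞ M)
    (hf : ContDiffOn ℝ 3 (fun z ↦ f (φ.symm z)) φ.target) (j i : Fin n) :
    ContDiffOn ℝ 1 (g.nabla₂ φ f j i) φ.target :=
  (contDiffOn_pd φ.open_target (contDiffOn_nabla₁ hf i) (by norm_num) j).sub
    (ContDiffOn.sum fun l _ ↦ ((g.contDiffOn_christoffel hφ l j i).of_le (by simp)).mul
      ((contDiffOn_nabla₁ hf l).of_le (by norm_num)))

namespace IsChartGeodesicAt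

variable {x v : ℝ → EuclideanSpace ℝ (Fin n)} {t : ℝ}

theorem hasDerivAt_velocity_apply (h : g.IsChartGeodesicAt φ x v t) (k : Fin n) :
    HasDerivAt (fun s ↦ v s k) (-∑ i, ∑ j, g.christoffel φ k i j (x t) * v t i * v t j) t :=
  hasDerivAt_apply h.hasDerivAt_velocity k

/-- The energy `g(γ', γ')` of a geodesic is conserved: the connection is metric. -/
theorem hasDerivAt_energy (hφ : φ ∈ IsManifold.maximalAtlas (𝓡 n) ∞ M)
    (h : g.IsChartGeodesicAt φ x v t) :
    HasDerivAt (fun s ↦ ∑ i, ∑ j, g.comp φ (x s) i j * v s i * v s j) 0 t := by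
  have hG (i j : Fin n) : HasDerivAt (fun s ↦ g.comp φ (x s) i j)
      (∑ k, pd k (fun z ↦ g.comp φ z i j) (x t) * v t k) t :=
    hasDerivAt_comp_sum_pd (((g.contDiffOn_comp hφ i j).contDiffAt
      (φ.open_target.mem_nhds h.mem)).differentiableAt (by simp)) h.hasDerivAt
  have hE := HasDerivAt.fun_sum fun i (_ : i ∈ Finset.univ) ↦
    HasDerivAt.fun_sum fun j (_ : j ∈ Finset.univ) ↦
      ((hG i j).fun_mul (h.hasDerivAt_velocity_apply i)).fun_mul (h.hasDerivAt_velocity_apply j)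
  refine hE.congr_deriv ?_
  set w := v t
  set y := x t
  set Γ := fun k i j ↦ g.christoffel φ k i j y
  set d := fun k i j ↦ pd k (fun z ↦ g.comp φ z i j) y
  set G := fun i j ↦ g.comp φ y i j
  -- `T` is the contraction of the derivative of the metric with three copies of the velocity.
  set T : ℝ := ∑ i, ∑ j, ∑ k, d k i j * w k * w i * w j with hT
  have hsym (i j : Fin n) : G i j = G j i := g.comp_symm i j
  have hdsym (k i j : Fin n) : d k i j = d k j i := by
    simp only [d, g.comp_symm i j]
  have hlow (m i j : Fin n) : ∑ k, G m k * Γ k i j = (1 / 2) * (d i j m + d j i m - d m i j) :=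
    g.sum_comp_mul_christoffel hφ h.mem m i j
  have hT1 : ∑ m, ∑ i, ∑ j, d i j m * w i * w j * w m = T := by
    rw [hT, Finset.sum_congr rfl fun m _ ↦ Finset.sum_comm]
    refine Finset.sum_congr rfl fun a _ ↦ Finset.sum_congr rfl fun b _ ↦
      Finset.sum_congr rfl fun c _ ↦ ?_
    rw [hdsym]; ring
  have hT2 : ∑ m, ∑ i, ∑ j, d j i m * w i * w j * w m = T := by
    refine Finset.sum_congr rfl fun a _ ↦ Finset.sum_congr rfl fun b _ ↦
      Finset.sum_congr rfl fun c _ ↦ ?_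
    rw [hdsym]; ring
  have hT3 : ∑ m, ∑ i, ∑ j, d m i j * w i * w j * w m = T := by
    rw [hT, Finset.sum_comm, Finset.sum_congr rfl fun m _ ↦ Finset.sum_comm]
    refine Finset.sum_congr rfl fun a _ ↦ Finset.sum_congr rfl fun b _ ↦
      Finset.sum_congr rfl fun c _ ↦ ?_
    ring
  have hacc : ∑ m, ∑ k, G m k * (∑ i, ∑ j, Γ k i j * w i * w j) * w m = (1 / 2) * T := by
    have h1 (m : Fin n) : ∑ k, G m k * (∑ i, ∑ j, Γ k i j * w i * w j) * w m
        = ∑ i, ∑ j, (1 / 2) * (d i j m * w i * w j * w m + d j i m * w i * w j * w m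
            - d m i j * w i * w j * w m) := by
      simp only [Finset.mul_sum, Finset.sum_mul]
      rw [Finset.sum_comm]
      refine Finset.sum_congr rfl fun i _ ↦ ?_
      rw [Finset.sum_comm]
      refine Finset.sum_congr rfl fun j _ ↦ ?_
      calc ∑ k, G m k * (Γ k i j * w i * w j) * w m
          = (∑ k, G m k * Γ k i j) * (w i * w j * w m) := by
            rw [Finset.sum_mul]; exact Finset.sum_congr rfl fun k _ ↦ by ring
        _ = _ := by rw [hlow]; ring
    simp only [h1, ← Finset.mul_sum, Finset.sum_add_distrib, Finset.sum_sub_distrib, hT1, hT2, hT3]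
    ring
  have e1 : ∑ i, ∑ j, (∑ k, d k i j * w k) * w i * w j = T := by
    rw [hT]
    simp only [Finset.sum_mul]
  have e2 : ∑ i, ∑ j, G i j * (∑ a, ∑ b, Γ i a b * w a * w b) * w j = (1 / 2) * T := by
    rw [Finset.sum_comm, ← hacc]
    exact Finset.sum_congr rfl fun a _ ↦ Finset.sum_congr rfl fun b _ ↦ by rw [hsym]
  have e3 : ∑ i, ∑ j, G i j * w i * (∑ a, ∑ b, Γ j a b * w a * w b) = (1 / 2) * T := by
    rw [← hacc]
    exact Finset.sum_congr rfl fun a _ ↦ Finset.sum_congr rfl fun b _ ↦ by ring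
  calc _ = ∑ i, ∑ j, (((∑ k, d k i j * w k) * w i
        + G i j * -(∑ a, ∑ b, Γ i a b * w a * w b)) * w j
        + G i j * w i * -(∑ a, ∑ b, Γ j a b * w a * w b)) := rfl
    _ = ∑ i, ∑ j, ((∑ k, d k i j * w k) * w i * w j
        - G i j * (∑ a, ∑ b, Γ i a b * w a * w b) * w j
        - G i j * w i * (∑ a, ∑ b, Γ j a b * w a * w b)) :=
        Finset.sum_congr rfl fun i _ ↦ Finset.sum_congr rfl fun j _ ↦ by ring
    _ = 0 := by
        simp only [Finset.sum_sub_distrib, e1, e2, e3]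
        ring

theorem hasDerivAt_comp (h : g.IsChartGeodesicAt φ x v t)
    (hf : ContDiffOn ℝ 3 (fun z ↦ f (φ.symm z)) φ.target) :
    HasDerivAt (fun s ↦ f (φ.symm (x s))) (∑ i, nabla₁ φ f i (x t) * v t i) t :=
  hasDerivAt_comp_sum_pd (f := fun z ↦ f (φ.symm z))
    ((hf.contDiffAt (φ.open_target.mem_nhds h.mem)).differentiableAt (by simp)) h.hasDerivAt

/-- The second derivative of `f` along a geodesic is the contraction of its covariant Hessian with
the velocity: the Christoffel terms are the acceleration. -/
theorem hasDerivAt_nabla₁ (h : g.IsChartGeodesicAt φ x v t)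
    (hf : ContDiffOn ℝ 3 (fun z ↦ f (φ.symm z)) φ.target) :
    HasDerivAt (fun s ↦ ∑ i, nabla₁ φ f i (x s) * v s i)
      (∑ j, ∑ i, g.nabla₂ φ f j i (x t) * v t j * v t i) t := by
  have h1 (i : Fin n) := hasDerivAt_comp_sum_pd (((contDiffOn_nabla₁ hf i).contDiffAt
    (φ.open_target.mem_nhds h.mem)).differentiableAt (by simp)) h.hasDerivAt
  refine (HasDerivAt.fun_sum fun i (_ : i ∈ Finset.univ) ↦
    (h1 i).fun_mul (h.hasDerivAt_velocity_apply i)).congr_deriv ?_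
  set w := v t
  set y := x t
  set Γ := fun k i j ↦ g.christoffel φ k i j y
  set N := fun i ↦ nabla₁ φ f i y
  set p := fun j i ↦ pd j (nabla₁ φ f i) y
  have e0 (j i : Fin n) : g.nabla₂ φ f j i y = p j i - ∑ l, Γ l j i * N l := rfl
  have e1 : ∑ j, ∑ i, p j i * w j * w i = ∑ i, (∑ j, p j i * w j) * w i := by
    rw [Finset.sum_comm]
    simp only [Finset.sum_mul]
  have e2 : ∑ j, ∑ i, (∑ l, Γ l j i * N l) * w j * w i
      = ∑ i, N i * (∑ a, ∑ b, Γ i a b * w a * w b) := by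
    simp only [Finset.sum_mul, Finset.mul_sum]
    calc _ = ∑ j, ∑ l, ∑ i, Γ l j i * N l * w j * w i :=
          Finset.sum_congr rfl fun j _ ↦ Finset.sum_comm
      _ = ∑ l, ∑ j, ∑ i, Γ l j i * N l * w j * w i := Finset.sum_comm
      _ = _ := Finset.sum_congr rfl fun l _ ↦ Finset.sum_congr rfl fun j _ ↦
          Finset.sum_congr rfl fun i _ ↦ by ring
  simp only [e0, sub_mul, Finset.sum_sub_distrib, e1, e2]
  simp only [← Finset.sum_sub_distrib]
  change ∑ i, ((∑ j, p j i * w j) * w i + N i * -(∑ a, ∑ b, Γ i a b * w a * w b)) = _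
  exact Finset.sum_congr rfl fun i _ ↦ by ring

/-- The third derivative of `f` along a geodesic is the contraction of its third covariant
derivative with the velocity. -/
theorem hasDerivAt_nabla₂ (hφ : φ ∈ IsManifold.maximalAtlas (𝓡 n) ∞ M)
    (h : g.IsChartGeodesicAt φ x v t)
    (hf : ContDiffOn ℝ 3 (fun z ↦ f (φ.symm z)) φ.target) :
    HasDerivAt (fun s ↦ ∑ j, ∑ i, g.nabla₂ φ f j i (x s) * v s j * v s i)
      (∑ k, ∑ j, ∑ i, g.nabla₃ φ f k j i (x t) * v t k * v t j * v t i) t := by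
  have h1 (j i : Fin n) := hasDerivAt_comp_sum_pd
    (((contDiffOn_nabla₂ (g := g) hφ hf j i).contDiffAt (φ.open_target.mem_nhds h.mem)).differentiableAt (by simp)) h.hasDerivAt
  refine (HasDerivAt.fun_sum fun j (_ : j ∈ Finset.univ) ↦ HasDerivAt.fun_sum fun i
    (_ : i ∈ Finset.univ) ↦ ((h1 j i).fun_mul (h.hasDerivAt_velocity_apply j)).fun_mul
      (h.hasDerivAt_velocity_apply i)).congr_deriv ?_
  set w := v t
  set y := x t
  set Γ := fun k i j ↦ g.christoffel φ k i j y
  set N := fun j i ↦ g.nabla₂ φ f j i y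
  set p := fun k j i ↦ pd k (g.nabla₂ φ f j i) y
  have e1 : ∑ k, ∑ j, ∑ i, p k j i * w k * w j * w i
      = ∑ j, ∑ i, (∑ k, p k j i * w k) * w j * w i := by
    rw [Finset.sum_comm]
    refine Finset.sum_congr rfl fun j _ ↦ ?_
    rw [Finset.sum_comm]
    simp only [Finset.sum_mul]
  have e2 : ∑ k, ∑ j, ∑ i, (∑ l, Γ l k j * N l i) * w k * w j * w i
      = ∑ j, ∑ i, N j i * (∑ a, ∑ b, Γ j a b * w a * w b) * w i := by
    simp only [Finset.sum_mul, Finset.mul_sum]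
    -- Both sides are sums over the four indices `l, i, k, j`.
    calc _ = ∑ k, ∑ j, ∑ l, ∑ i, Γ l k j * N l i * w k * w j * w i :=
          Finset.sum_congr rfl fun k _ ↦ Finset.sum_congr rfl fun j _ ↦ Finset.sum_comm
      _ = ∑ k, ∑ l, ∑ j, ∑ i, Γ l k j * N l i * w k * w j * w i :=
          Finset.sum_congr rfl fun k _ ↦ Finset.sum_comm
      _ = ∑ l, ∑ k, ∑ j, ∑ i, Γ l k j * N l i * w k * w j * w i := Finset.sum_comm
      _ = ∑ l, ∑ k, ∑ i, ∑ j, Γ l k j * N l i * w k * w j * w i :=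
          Finset.sum_congr rfl fun l _ ↦ Finset.sum_congr rfl fun k _ ↦ Finset.sum_comm
      _ = ∑ l, ∑ i, ∑ k, ∑ j, Γ l k j * N l i * w k * w j * w i :=
          Finset.sum_congr rfl fun l _ ↦ Finset.sum_comm
      _ = _ := Finset.sum_congr rfl fun l _ ↦ Finset.sum_congr rfl fun i _ ↦
          Finset.sum_congr rfl fun k _ ↦ Finset.sum_congr rfl fun j _ ↦ by ring
  have e3 : ∑ k, ∑ j, ∑ i, (∑ l, Γ l k i * N j l) * w k * w j * w i
      = ∑ j, ∑ i, N j i * w j * (∑ a, ∑ b, Γ i a b * w a * w b) := by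
    simp only [Finset.sum_mul, Finset.mul_sum]
    calc _ = ∑ j, ∑ k, ∑ i, ∑ l, Γ l k i * N j l * w k * w j * w i := Finset.sum_comm
      _ = ∑ j, ∑ k, ∑ l, ∑ i, Γ l k i * N j l * w k * w j * w i :=
          Finset.sum_congr rfl fun j _ ↦ Finset.sum_congr rfl fun k _ ↦ Finset.sum_comm
      _ = ∑ j, ∑ l, ∑ k, ∑ i, Γ l k i * N j l * w k * w j * w i :=
          Finset.sum_congr rfl fun j _ ↦ Finset.sum_comm
      _ = _ := Finset.sum_congr rfl fun j _ ↦ Finset.sum_congr rfl fun l _ ↦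
          Finset.sum_congr rfl fun k _ ↦ Finset.sum_congr rfl fun i _ ↦ by ring
  have e0 (k j i : Fin n) : g.nabla₃ φ f k j i y
      = p k j i - (∑ l, Γ l k j * N l i) - ∑ l, Γ l k i * N j l := rfl
  simp only [e0, sub_mul, Finset.sum_sub_distrib, e1, e2, e3]
  simp only [← Finset.sum_sub_distrib]
  change ∑ j, ∑ i, (((∑ k, p k j i * w k) * w j
      + N j i * -(∑ a, ∑ b, Γ j a b * w a * w b)) * w i
      + N j i * w j * -(∑ a, ∑ b, Γ i a b * w a * w b)) = _
  exact Finset.sum_congr rfl fun i _ ↦ Finset.sum_congr rfl fun j _ ↦ by ring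

/-- Along a geodesic, the Gallot–Tanno equation becomes `h''' = -4 g(γ', γ') h'`. -/
theorem sum_nabla₃_eq (h : g.IsChartGeodesicAt φ x v t)
    (hφ : φ ∈ IsManifold.maximalAtlas (𝓡 n) ∞ M) (hf : g.IsGallotTannoSolution f) :
    ∑ k, ∑ j, ∑ i, g.nabla₃ φ f k j i (x t) * v t k * v t j * v t i
      = -4 * (∑ i, ∑ j, g.comp φ (x t) i j * v t i * v t j)
          * ∑ i, nabla₁ φ f i (x t) * v t i := by
  set w := v t
  set y := x t
  have h0 (k j i : Fin n) : g.nabla₃ φ f k j i y * w k * w j * w i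
      = -(2 * ((nabla₁ φ f k y * w k) * (g.comp φ y j i * w j * w i))
        + (nabla₁ φ f i y * w i) * (g.comp φ y k j * w k * w j)
        + (nabla₁ φ f j y * w j) * (g.comp φ y k i * w k * w i)) := by
    have := hf.2 φ hφ y h.mem i j k
    rw [g.comp_symm i j, g.comp_symm j k, g.comp_symm i k] at this
    linear_combination (w k * w j * w i) * this
  set E : ℝ := ∑ i, ∑ j, g.comp φ y i j * w i * w j with hE
  set D : ℝ := ∑ i, nabla₁ φ f i y * w i with hD
  have s1 : ∑ k, ∑ j, ∑ i, (nabla₁ φ f k y * w k) * (g.comp φ y j i * w j * w i) = D * E := by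
    rw [hD, Finset.sum_mul]
    simp only [hE, Finset.mul_sum]
  have s2 : ∑ k, ∑ j, ∑ i, (nabla₁ φ f i y * w i) * (g.comp φ y k j * w k * w j) = D * E := by
    simp only [← Finset.sum_mul, ← Finset.mul_sum, hE, hD]
  have s3 : ∑ k, ∑ j, ∑ i, (nabla₁ φ f j y * w j) * (g.comp φ y k i * w k * w i) = D * E := by
    rw [← s2]
    exact Finset.sum_congr rfl fun k _ ↦ Finset.sum_comm
  simp only [h0, Finset.sum_neg_distrib, Finset.sum_add_distrib, ← Finset.mul_sum (a := (2 : ℝ)),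
    s1, s2, s3]
  ring

end IsChartGeodesicAt

end Metric

end Curves

/-! ### Existence of geodesics and their description in a chart -/

section Geodesics

variable {n : ℕ} {M : Type*} [TopologicalSpace M] [ChartedSpace (EuclideanSpace ℝ (Fin n)) M]
  [IsManifold (𝓡 n) ∞ M] {g : Metric n M}
  {φ : OpenPartialHomeomorph M (EuclideanSpace ℝ (Fin n))}

namespace Metric

theorem contDiffOn_acceleration (hφ : φ ∈ IsManifold.maximalAtlas (𝓡 n) ∞ M) :
    ContDiffOn ℝ ∞
      (fun p : EuclideanSpace ℝ (Fin n) × EuclideanSpace ℝ (Fin n) ↦ g.acceleration φ p.1 p.2)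
      (φ.target ×ˢ Set.univ) := by
  rw [contDiffOn_piLp]
  intro k
  have hv (i : Fin n) : ContDiff ℝ ∞
      (fun p : EuclideanSpace ℝ (Fin n) × EuclideanSpace ℝ (Fin n) ↦ p.2 i) :=
    (contDiff_piLp_apply (p := 2) (i := i)).comp contDiff_snd
  have hΓ (i j : Fin n) : ContDiffOn ℝ ∞
      (fun p : EuclideanSpace ℝ (Fin n) × EuclideanSpace ℝ (Fin n) ↦ g.christoffel φ k i j p.1)
      (φ.target ×ˢ Set.univ) :=
    (g.contDiffOn_christoffel hφ k i j).comp contDiff_fst.contDiffOn fun p hp ↦ hp.1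
  exact (ContDiffOn.sum fun i _ ↦ ContDiffOn.sum fun j _ ↦
    ((hΓ i j).mul (hv i).contDiffOn).mul (hv j).contDiffOn).neg

/-- Through every point of a chart there is a geodesic, defined for a short time, with any
prescribed nonzero initial velocity; its velocity stays nonzero. -/
theorem exists_isChartGeodesicAt (hφ : φ ∈ IsManifold.maximalAtlas (𝓡 n) ∞ M)
    {y u : EuclideanSpace ℝ (Fin n)} (hy : y ∈ φ.target) (hu : u ≠ 0) :
    ∃ x v : ℝ → EuclideanSpace ℝ (Fin n), x 0 = y ∧ v 0 = u ∧ ∃ ε > 0,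
      ∀ t ∈ Set.Ioo (-ε) ε, g.IsChartGeodesicAt φ x v t ∧ v t ≠ 0 := by
  have hopen : IsOpen (φ.target ×ˢ (Set.univ : Set (EuclideanSpace ℝ (Fin n)))) :=
    φ.open_target.prod isOpen_univ
  have hX : ContDiffAt ℝ 1
      (fun p : EuclideanSpace ℝ (Fin n) × EuclideanSpace ℝ (Fin n) ↦
        (p.2, g.acceleration φ p.1 p.2)) (y, u) :=
    contDiffAt_snd.prodMk (((contDiffOn_acceleration hφ).contDiffAt
      (hopen.mem_nhds ⟨hy, trivial⟩)).of_le (by simp))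
  obtain ⟨α, hα0, ε, hε, hα⟩ :=
    hX.exists_forall_mem_closedBall_exists_eq_forall_mem_Ioo_hasDerivAt₀ 0
  rw [zero_sub, zero_add] at hα
  have hαc : ContinuousAt α 0 := (hα 0 ⟨by linarith, hε⟩).continuousAt
  have hx : ∀ᶠ t in 𝓝 (0 : ℝ), (α t).1 ∈ φ.target :=
    hαc.fst.eventually_mem (φ.open_target.mem_nhds (by rwa [hα0]))
  have hv : ∀ᶠ t in 𝓝 (0 : ℝ), (α t).2 ≠ 0 :=
    hαc.snd.eventually_ne (by rwa [hα0])
  obtain ⟨δ, hδ, hball⟩ := Metric.eventually_nhds_iff_ball.1 (hx.and hv)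
  refine ⟨fun t ↦ (α t).1, fun t ↦ (α t).2, by simp [hα0], by simp [hα0], min ε δ, by positivity,
    fun t ht ↦ ?_⟩
  have htε : t ∈ Set.Ioo (-ε) ε :=
    ⟨by linarith [ht.1, min_le_left ε δ], by linarith [ht.2, min_le_left ε δ]⟩
  have htδ : t ∈ Metric.ball (0 : ℝ) δ := by
    rw [Real.ball_eq_Ioo]
    exact ⟨by linarith [ht.1, min_le_right ε δ], by linarith [ht.2, min_le_right ε δ]⟩
  exact ⟨⟨(hball t htδ).1, (hα t htε).fst, (hα t htε).snd⟩, (hball t htδ).2⟩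

/-- A solution of the geodesic equation in a chart is a geodesic. -/
theorem isGeodesicOn_of_isChartGeodesicAt (hφ : φ ∈ IsManifold.maximalAtlas (𝓡 n) ∞ M)
    {x v : ℝ → EuclideanSpace ℝ (Fin n)} {J : Set ℝ} (hJ : IsOpen J)
    (h : ∀ t ∈ J, g.IsChartGeodesicAt φ x v t) :
    g.IsGeodesicOn (fun t ↦ φ.symm (x t)) J := by
  have hxc : ContinuousOn x J := fun t ht ↦ (h t ht).hasDerivAt.continuousAt.continuousWithinAt
  have hvc : ContinuousOn v J :=
    fun t ht ↦ (h t ht).hasDerivAt_velocity.continuousAt.continuousWithinAt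
  have hmaps : Set.MapsTo (fun t ↦ (x t, v t)) J (φ.target ×ˢ Set.univ) :=
    fun t ht ↦ ⟨(h t ht).mem, Set.mem_univ _⟩
  have hac := (contDiffOn_acceleration (g := g) hφ).continuousOn.comp (hxc.prodMk hvc) hmaps
  have hv1 : ContDiffOn ℝ 1 v J := by
    rw [show (1 : ℕ∞ω) = 0 + 1 by simp, contDiffOn_succ_iff_deriv_of_isOpen hJ]
    exact ⟨fun t ht ↦ (h t ht).hasDerivAt_velocity.differentiableAt.differentiableWithinAt,
      by simp, contDiffOn_zero.2 (hac.congr fun t ht ↦ (h t ht).hasDerivAt_velocity.deriv)⟩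
  have hx2 : ContDiffOn ℝ 2 x J := by
    rw [show (2 : ℕ∞ω) = 1 + 1 by norm_num, contDiffOn_succ_iff_deriv_of_isOpen hJ]
    exact ⟨fun t ht ↦ (h t ht).hasDerivAt.differentiableAt.differentiableWithinAt,
      by simp, hv1.congr fun t ht ↦ (h t ht).hasDerivAt.deriv⟩
  have hφ2 : ContMDiffOn (𝓡 n) (𝓡 n) 2 φ.symm φ.target :=
    (contMDiffOn_symm_of_mem_maximalAtlas hφ).of_le
      ENat.LEInfty.out
  have hγ : ContMDiffOn 𝓘(ℝ, ℝ) (𝓡 n) 2 (fun t ↦ φ.symm (x t)) J :=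
    hφ2.comp hx2.contMDiffOn fun t ht ↦ (h t ht).mem
  refine ⟨hγ, fun t₀ ht₀ ↦ ⟨φ, hφ, φ.map_target (h t₀ ht₀).mem, ?_⟩⟩
  filter_upwards [hJ.mem_nhds ht₀] with t ht k
  have e1 (i : Fin n) (s : ℝ) (hs : s ∈ J) :
      (fun r ↦ φ (φ.symm (x r)) i) =ᶠ[𝓝 s] fun r ↦ x r i := by
    filter_upwards [hJ.mem_nhds hs] with r hr
    rw [φ.right_inv (h r hr).mem]
  have e2 (i : Fin n) (s : ℝ) (hs : s ∈ J) : deriv (fun r ↦ φ (φ.symm (x r)) i) s = v s i :=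
    (e1 i s hs).deriv_eq.trans (hasDerivAt_apply (h s hs).hasDerivAt i).deriv
  have e3 : deriv (fun r ↦ φ (φ.symm (x r)) k) =ᶠ[𝓝 t] fun s ↦ v s k := by
    filter_upwards [hJ.mem_nhds ht] with s hs using e2 k s hs
  rw [e3.deriv_eq, ((h t ht).hasDerivAt_velocity_apply k).deriv, φ.right_inv (h t ht).mem]
  simp only [e2 _ t ht]
  ring

/-- Near each of its parameters, a geodesic solves the geodesic equation in some chart. -/
theorem IsGeodesicOn.exists_isChartGeodesicAt {γ : ℝ → M} {J : Set ℝ} (hJ : IsOpen J)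
    (h : g.IsGeodesicOn γ J) {t₀ : ℝ} (ht₀ : t₀ ∈ J) :
    ∃ φ ∈ IsManifold.maximalAtlas (𝓡 n) ∞ M, ∃ x v : ℝ → EuclideanSpace ℝ (Fin n),
      ∀ᶠ t in 𝓝 t₀, γ t = φ.symm (x t) ∧ g.IsChartGeodesicAt φ x v t := by
  obtain ⟨hγ, hgeo⟩ := h
  obtain ⟨φ, hφ, hmem, heq⟩ := hgeo t₀ ht₀
  have hγc : ContinuousAt γ t₀ := hγ.continuousOn.continuousAt (hJ.mem_nhds ht₀)
  have hsrc : ∀ᶠ t in 𝓝 t₀, γ t ∈ φ.source ∧ t ∈ J :=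
    (hγc.eventually_mem (φ.open_source.mem_nhds hmem)).and (hJ.mem_nhds ht₀)
  obtain ⟨U, hU, hUo, ht₀U⟩ := eventually_nhds_iff.1 hsrc
  let x : ℝ → EuclideanSpace ℝ (Fin n) := fun t ↦ φ (γ t)
  have hx2 : ContDiffOn ℝ 2 x U := by
    rw [← contMDiffOn_iff_contDiffOn]
    have hφ2 : ContMDiffOn (𝓡 n) (𝓡 n) 2 φ φ.source :=
      (contMDiffOn_of_mem_maximalAtlas hφ).of_le ENat.LEInfty.out
    exact hφ2.comp (hγ.mono fun t ht ↦ (hU t ht).2) fun t ht ↦ (hU t ht).1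
  rw [show (2 : ℕ∞ω) = 1 + 1 by norm_num, contDiffOn_succ_iff_deriv_of_isOpen hUo] at hx2
  have hx (t : ℝ) (ht : t ∈ U) : HasDerivAt x (deriv x t) t :=
    (hx2.1.differentiableAt (hUo.mem_nhds ht)).hasDerivAt
  have hv (t : ℝ) (ht : t ∈ U) : HasDerivAt (deriv x) (deriv (deriv x) t) t :=
    ((hx2.2.2.contDiffAt (hUo.mem_nhds ht)).differentiableAt (by simp)).hasDerivAt
  refine ⟨φ, hφ, x, deriv x, ?_⟩
  filter_upwards [hUo.mem_nhds ht₀U, heq] with t ht heqt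
  refine ⟨(φ.left_inv (hU t ht).1).symm, φ.map_source (hU t ht).1, hx t ht, ?_⟩
  refine (hv t ht).congr_deriv ?_
  ext k
  have e1 (i : Fin n) (s : ℝ) (hs : s ∈ U) : deriv (fun r ↦ φ (γ r) i) s = deriv x s i :=
    (hasDerivAt_apply (hx s hs) i).deriv
  have e2 : deriv (fun r ↦ φ (γ r) k) =ᶠ[𝓝 t] fun s ↦ deriv x s k := by
    filter_upwards [hUo.mem_nhds ht] with s hs using e1 k s hs
  have := heqt k
  rw [e2.deriv_eq, (hasDerivAt_apply (hv t ht) k).deriv] at this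
  simp only [e1 _ t ht] at this
  exact eq_neg_of_add_eq_zero_left this

/-- The energy of a geodesic is constant. -/
theorem IsGeodesicOn.hasDerivAt_energy {γ : ℝ → M} {J : Set ℝ} (hJ : IsOpen J)
    (h : g.IsGeodesicOn γ J) {t : ℝ} (ht : t ∈ J) : HasDerivAt (g.energy γ) 0 t := by
  obtain ⟨φ, hφ, x, v, hxv⟩ := h.exists_isChartGeodesicAt hJ ht
  refine (hxv.self_of_nhds.2.hasDerivAt_energy hφ).congr_of_eventuallyEq ?_
  filter_upwards [hxv.eventually_nhds] with s hs
  exact energy_eq_sum hφ hs.self_of_nhds.2.mem (hs.mono fun _ h ↦ h.1) hs.self_of_nhds.2.hasDerivAt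

/-- A solution of the Gallot–Tanno equation satisfies `h''' = -4 g(γ', γ') h'` along every
geodesic `γ`. -/
theorem IsGallotTannoSolution.hasDerivAt_comp_geodesic {f : M → ℝ} (hf : g.IsGallotTannoSolution f)
    {γ : ℝ → M} {J : Set ℝ} (hJ : IsOpen J) (h : g.IsGeodesicOn γ J) {t : ℝ} (ht : t ∈ J) :
    HasDerivAt (fun s ↦ f (γ s)) (deriv (fun s ↦ f (γ s)) t) t ∧
    HasDerivAt (deriv fun s ↦ f (γ s)) (deriv (deriv fun s ↦ f (γ s)) t) t ∧
    HasDerivAt (deriv (deriv fun s ↦ f (γ s)))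
      (-4 * g.energy γ t * deriv (fun s ↦ f (γ s)) t) t := by
  obtain ⟨φ, hφ, x, v, hxv⟩ := h.exists_isChartGeodesicAt hJ ht
  have hfφ := contDiffOn_comp_chart_symm hf.1 hφ
  have d0 : ∀ᶠ s in 𝓝 t, HasDerivAt (fun s ↦ f (γ s)) (∑ i, nabla₁ φ f i (x s) * v s i) s := by
    filter_upwards [hxv.eventually_nhds] with s hs
    exact (hs.self_of_nhds.2.hasDerivAt_comp hfφ).congr_of_eventuallyEq
      (hs.mono fun r hr ↦ congrArg f hr.1)
  have d1 : ∀ᶠ s in 𝓝 t, HasDerivAt (deriv fun s ↦ f (γ s))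
      (∑ j, ∑ i, g.nabla₂ φ f j i (x s) * v s j * v s i) s := by
    filter_upwards [hxv, d0.eventually_nhds] with s hs hd
    exact (hs.2.hasDerivAt_nabla₁ hfφ).congr_of_eventuallyEq (hd.mono fun r hr ↦ hr.deriv)
  have d2 := (hxv.self_of_nhds.2.hasDerivAt_nabla₂ hφ hfφ).congr_of_eventuallyEq
    (d1.mono fun r hr ↦ hr.deriv)
  refine ⟨d0.self_of_nhds.differentiableAt.hasDerivAt, d1.self_of_nhds.differentiableAt.hasDerivAt,
    d2.congr_deriv ?_⟩
  rw [d0.self_of_nhds.deriv, hxv.self_of_nhds.2.sum_nabla₃_eq hφ hf,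
    energy_eq_sum hφ hxv.self_of_nhds.2.mem (hxv.mono fun _ h ↦ h.1) hxv.self_of_nhds.2.hasDerivAt]

end Metric

end Geodesics

/-! ### Indefinite quadratic forms -/

section Algebra

variable {V : Type*} [AddCommGroup V] [Module ℝ V] {B : V →ₗ[ℝ] V →ₗ[ℝ] ℝ}

theorem exists_two_roots_of_mul_neg {a b c : ℝ} (h : a * c < 0) :
    ∃ t₁ t₂ : ℝ, t₁ ≠ t₂ ∧ a * t₁ ^ 2 + 2 * b * t₁ + c = 0 ∧ a * t₂ ^ 2 + 2 * b * t₂ + c = 0 := by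
  have ha : a ≠ 0 := by rintro rfl; simp at h
  have hpos : 0 < b ^ 2 - a * c := by nlinarith [sq_nonneg b]
  have hs : √(b ^ 2 - a * c) ^ 2 = b ^ 2 - a * c := Real.sq_sqrt hpos.le
  have hne : √(b ^ 2 - a * c) ≠ 0 := (Real.sqrt_pos.2 hpos).ne'
  set s := √(b ^ 2 - a * c)
  refine ⟨(-b + s) / a, (-b - s) / a, fun he ↦ hne ?_, ?_, ?_⟩
  · field_simp at he
    linarith
  · field_simp
    linear_combination hs
  · field_simp
    linear_combination hs

/-- The null vectors of an indefinite symmetric form span: a linear functional that vanishes on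
them is zero. Each vector that is not null lies on a line, in the direction of a vector of the
opposite sign, that meets the null cone twice. -/
theorem eq_zero_of_vanish_on_null (hB : ∀ v w, B v w = B w v) {a b : V} (ha : 0 < B a a)
    (hb : B b b < 0) {l : V →ₗ[ℝ] ℝ} (hl : ∀ v, B v v = 0 → l v = 0) : l = 0 := by
  have key {v w : V} (h : B w w * B v v < 0) : l v = 0 := by
    obtain ⟨t₁, t₂, hne, h₁, h₂⟩ := exists_two_roots_of_mul_neg (b := B v w) h
    have hline (t : ℝ) (ht : B w w * t ^ 2 + 2 * B v w * t + B v v = 0) : l v + t * l w = 0 := by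
      have : B (v + t • w) (v + t • w) = 0 := by
        simp only [map_add, map_smul, LinearMap.add_apply, LinearMap.smul_apply, smul_eq_mul,
          hB w v]
        linear_combination ht
      simpa using hl _ this
    have e₁ := hline t₁ h₁
    have e₂ := hline t₂ h₂
    have hw : l w = 0 := by
      have : (t₁ - t₂) * l w = 0 := by linear_combination e₁ - e₂
      exact (mul_eq_zero.1 this).resolve_left (sub_ne_zero.2 hne)
    simpa [hw] using e₁
  ext v
  rcases lt_trichotomy (B v v) 0 with h | h | h
  · exact key (mul_neg_of_pos_of_neg ha h)
  · exact hl v h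
  · exact key (mul_neg_of_neg_of_pos hb h)

/-- A null vector of a semidefinite symmetric form lies in its radical. -/
theorem apply_eq_zero_of_semidefinite (hB : ∀ v w, B v w = B w v) (hpos : ∀ v, 0 ≤ B v v) {v : V}
    (hv : B v v = 0) (w : V) : B v w = 0 := by
  by_contra hne
  have h := hpos (v + (-(B v w) / (B w w + 1)) • w)
  have hc := hpos w
  simp only [map_add, map_smul, LinearMap.add_apply, LinearMap.smul_apply, smul_eq_mul, hB w v,
    hv] at h
  have e : 0 + -B v w / (B w w + 1) * B v w +
      -B v w / (B w w + 1) * (B v w + -B v w / (B w w + 1) * B w w)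
      = -((B v w) ^ 2 * (B w w + 2) / (B w w + 1) ^ 2) := by
    field_simp
    ring
  have : 0 < (B v w) ^ 2 * (B w w + 2) / (B w w + 1) ^ 2 := by positivity
  linarith

end Algebra

section Indefinite

variable {n : ℕ} {M : Type*} [TopologicalSpace M] [ChartedSpace (EuclideanSpace ℝ (Fin n)) M]
  [IsManifold (𝓡 n) ∞ M] (g : Metric n M)

namespace Metric

/-- By nondegeneracy, a semidefinite metric is definite. -/
theorem pos_of_semidefinite {s : ℝ} (hs : s ≠ 0) {x : M}
    (h : ∀ v : TangentSpace (𝓡 n) x, 0 ≤ s * g.form x v v) {v : TangentSpace (𝓡 n) x}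
    (hv : v ≠ 0) : 0 < s * g.form x v v := by
  refine lt_of_le_of_ne (h v) fun h0 ↦ hv (g.nondegenerate x v fun w ↦ ?_)
  let L : EuclideanSpace ℝ (Fin n) →L[ℝ] EuclideanSpace ℝ (Fin n) →L[ℝ] ℝ := g.form x
  let B : EuclideanSpace ℝ (Fin n) →ₗ[ℝ] EuclideanSpace ℝ (Fin n) →ₗ[ℝ] ℝ :=
    s • L.toLinearMap₁₂
  have := apply_eq_zero_of_semidefinite (B := B) (fun a b ↦ congrArg (s * ·) (g.symm x a b)) h
    h0.symm w
  exact (mul_eq_zero.1 this).resolve_left hs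

theorem exists_linearEquiv_form_eq {φ : OpenPartialHomeomorph M (EuclideanSpace ℝ (Fin n))}
    (hφ : φ ∈ IsManifold.maximalAtlas (𝓡 n) ∞ M) {x : M} (hx : x ∈ φ.source) :
    ∃ D : EuclideanSpace ℝ (Fin n) ≃ₗ[ℝ] TangentSpace (𝓡 n) x, ∀ u,
      g.form x (D u) (D u) = ∑ i, ∑ j, g.comp φ (φ x) i j * u i * u j := by
  obtain ⟨y, hy, rfl⟩ : ∃ y ∈ φ.target, φ.symm y = x := ⟨_, φ.map_source hx, φ.left_inv hx⟩
  rw [φ.right_inv hy]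
  exact ⟨LinearEquiv.ofBijective (mfderiv (𝓡 n) (𝓡 n) φ.symm y).toLinearMap
    ⟨mfderiv_chart_symm_injective hφ hy, mfderiv_chart_symm_surjective hφ hy⟩,
    fun u ↦ g.form_mfderiv_chart_symm u u⟩

theorem continuousOn_quadratic {φ : OpenPartialHomeomorph M (EuclideanSpace ℝ (Fin n))}
    (hφ : φ ∈ IsManifold.maximalAtlas (𝓡 n) ∞ M) :
    ContinuousOn (fun p : M × EuclideanSpace ℝ (Fin n) ↦
      ∑ i, ∑ j, g.comp φ (φ p.1) i j * p.2 i * p.2 j) (φ.source ×ˢ Set.univ) := by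
  have hG (i j : Fin n) : ContinuousOn (fun p : M × EuclideanSpace ℝ (Fin n) ↦
      g.comp φ (φ p.1) i j) (φ.source ×ˢ Set.univ) :=
    (g.contDiffOn_comp hφ i j).continuousOn.comp
      (φ.continuousOn.comp continuousOn_fst fun p hp ↦ hp.1) fun p hp ↦ φ.map_source hp.1
  have hu (i : Fin n) : Continuous fun p : M × EuclideanSpace ℝ (Fin n) ↦ p.2 i := by fun_prop
  exact continuousOn_finsetSum _ fun i _ ↦ continuousOn_finsetSum _ fun j _ ↦
    ((hG i j).mul (hu i).continuousOn).mul (hu j).continuousOn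

/-- On a connected manifold a nondegenerate metric has constant index, so an indefinite metric
takes both signs on each tangent space. This is stated for `s • g`, where `s ≠ 0`: the set of
points where this form is positive semidefinite is closed, and it is open, because there the form
is positive definite by nondegeneracy. -/
theorem IsIndefinite.exists_mul_neg [ConnectedSpace M] {g : Metric n M} (hg : g.IsIndefinite)
    {s : ℝ} (hs : s ≠ 0) (x : M) : ∃ v : TangentSpace (𝓡 n) x, s * g.form x v v < 0 := by
  by_contra! hx
  let S : Set M := {x | ∀ v : TangentSpace (𝓡 n) x, 0 ≤ s * g.form x v v}
  have hopen : IsOpen S := by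
    rw [isOpen_iff_mem_nhds]
    intro x hx
    have hφ := IsManifold.chart_mem_maximalAtlas (I := 𝓡 n) (n := ∞) x
    have hxφ := mem_chart_source (EuclideanSpace ℝ (Fin n)) x
    set φ := chartAt (EuclideanSpace ℝ (Fin n)) x
    have hpos : ∀ u ∈ Metric.sphere (0 : EuclideanSpace ℝ (Fin n)) 1,
        ∀ᶠ p : M × EuclideanSpace ℝ (Fin n) in 𝓝 (x, u),
          0 < s * ∑ i, ∑ j, g.comp φ (φ p.1) i j * p.2 i * p.2 j := by
      intro u hu
      obtain ⟨D, hD⟩ := g.exists_linearEquiv_form_eq hφ hxφ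
      have hu0 : u ≠ 0 := ne_zero_of_mem_unit_sphere ⟨u, hu⟩
      have h0 := g.pos_of_semidefinite hs hx (D.map_ne_zero_iff.2 hu0)
      rw [hD] at h0
      have hc := (g.continuousOn_quadratic hφ).continuousAt
        ((φ.open_source.prod isOpen_univ).mem_nhds
          (⟨hxφ, Set.mem_univ u⟩ : (x, u) ∈ φ.source ×ˢ Set.univ))
      exact continuousAt_const.eventually_lt (hc.const_mul s) h0
    have hpos' := (isCompact_sphere (0 : EuclideanSpace ℝ (Fin n))
      1).eventually_forall_of_forall_eventually
      (P := fun z u ↦ 0 < s * ∑ i, ∑ j, g.comp φ (φ z) i j * u i * u j) hpos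
    filter_upwards [φ.open_source.mem_nhds hxφ, hpos'] with z hz hzpos v
    obtain ⟨D, hD⟩ := g.exists_linearEquiv_form_eq hφ hz
    obtain ⟨u, rfl⟩ := D.surjective v
    rcases eq_or_ne u 0 with rfl | hu
    · simp
    · have hpos := hzpos (‖u‖⁻¹ • u) (by simp [norm_smul, hu])
      rw [← hD] at hpos
      have hscale : g.form z (D u) (D u)
          = ‖u‖ ^ 2 * g.form z (D (‖u‖⁻¹ • u)) (D (‖u‖⁻¹ • u)) := by
        have hu' : ‖u‖ ≠ 0 := norm_ne_zero_iff.2 hu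
        simp only [map_smul, smul_apply, smul_eq_mul]
        field_simp
      rw [hscale, mul_left_comm]
      positivity
  have hclosed : IsClosed S := by
    rw [← isOpen_compl_iff, isOpen_iff_mem_nhds]
    intro x hx
    have hφ := IsManifold.chart_mem_maximalAtlas (I := 𝓡 n) (n := ∞) x
    have hxφ := mem_chart_source (EuclideanSpace ℝ (Fin n)) x
    set φ := chartAt (EuclideanSpace ℝ (Fin n)) x
    obtain ⟨v, hv⟩ : ∃ v : TangentSpace (𝓡 n) x, s * g.form x v v < 0 := by
      simpa only [S, Set.mem_compl_iff, Set.mem_ofPred_eq, not_forall, not_le] using hx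
    obtain ⟨D, hD⟩ := g.exists_linearEquiv_form_eq hφ hxφ
    obtain ⟨u, rfl⟩ := D.surjective v
    rw [hD] at hv
    have hc := ((g.continuousOn_quadratic hφ).continuousAt
      ((φ.open_source.prod isOpen_univ).mem_nhds
        (⟨hxφ, Set.mem_univ u⟩ : (x, u) ∈ φ.source ×ˢ Set.univ))).comp
      (f := fun z ↦ (z, u)) (x := x) (by fun_prop)
    filter_upwards [φ.open_source.mem_nhds hxφ,
      (hc.const_mul s).eventually_lt continuousAt_const hv] with z hz hzu hzS
    obtain ⟨D, hD⟩ := g.exists_linearEquiv_form_eq hφ hz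
    exact hzu.not_ge ((hzS (D u)).trans_eq (by rw [hD]; rfl))
  have huniv : S = Set.univ := IsClopen.eq_univ ⟨hclosed, hopen⟩ ⟨x, hx⟩
  exact hg s fun z v hv ↦ g.pos_of_semidefinite hs (huniv ▸ Set.mem_univ z : z ∈ S) hv

end Metric

end Indefinite

/-! ### Solutions along null geodesics -/

/-- A bounded function on the line whose third derivative vanishes has vanishing first
derivative. -/
theorem deriv_eq_zero_of_bounded_of_third_deriv_eq_zero {h h₁ h₂ : ℝ → ℝ}
    (d₀ : ∀ t, HasDerivAt h (h₁ t) t) (d₁ : ∀ t, HasDerivAt h₁ (h₂ t) t)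
    (d₂ : ∀ t, HasDerivAt h₂ 0 t) {C : ℝ} (hC : ∀ t, |h t| ≤ C) : h₁ 0 = 0 := by
  have c₂ (t : ℝ) : h₂ t = h₂ 0 :=
    is_const_of_deriv_eq_zero (fun s ↦ (d₂ s).differentiableAt) (fun s ↦ (d₂ s).deriv) t 0
  have d₁' (t : ℝ) : HasDerivAt (fun t ↦ h₁ t - h₂ 0 * t) 0 t :=
    ((d₁ t).sub ((hasDerivAt_id t).const_mul (h₂ 0))).congr_deriv (by rw [c₂ t]; ring)
  have c₁ (t : ℝ) : h₁ t = h₁ 0 + h₂ 0 * t := by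
    have := is_const_of_deriv_eq_zero (fun s ↦ (d₁' s).differentiableAt) (fun s ↦ (d₁' s).deriv) t 0
    linarith
  have d₀' (t : ℝ) : HasDerivAt (fun t ↦ h t - (h₁ 0 * t + h₂ 0 / 2 * t ^ 2)) 0 t := by
    refine ((d₀ t).sub (((hasDerivAt_id t).const_mul (h₁ 0)).add
      ((hasDerivAt_pow 2 t).const_mul (h₂ 0 / 2)))).congr_deriv ?_
    rw [c₁ t]
    simp
    ring
  have c₀ (t : ℝ) : h t = h 0 + h₁ 0 * t + h₂ 0 / 2 * t ^ 2 := by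
    have := is_const_of_deriv_eq_zero (fun s ↦ (d₀' s).differentiableAt) (fun s ↦ (d₀' s).deriv) t 0
    norm_num at this
    linarith
  -- The odd part `h₁ 0 * t` of the quadratic polynomial `h` is bounded.
  by_contra hne
  have hb (t : ℝ) : |h₁ 0 * t| ≤ C := by
    have h1 := abs_le.1 (hC t)
    have h2 := abs_le.1 (hC (-t))
    rw [c₀ t] at h1
    rw [c₀ (-t)] at h2
    rw [abs_le]
    constructor <;> nlinarith
  have := hb ((C + 1) / h₁ 0)
  rw [mul_div_cancel₀ _ hne] at this
  linarith [le_abs_self (C + 1)]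

section Main

variable {n : ℕ} {M : Type*} [TopologicalSpace M] [ChartedSpace (EuclideanSpace ℝ (Fin n)) M]
  [IsManifold (𝓡 n) ∞ M] {g : Metric n M}
  {φ : OpenPartialHomeomorph M (EuclideanSpace ℝ (Fin n))} {f : M → ℝ}

namespace Metric

/-- The differential of a solution of the Gallot–Tanno equation kills every null vector `u`: along
the complete null geodesic with initial velocity `u`, the solution is a bounded quadratic
polynomial of the parameter. -/
theorem IsGallotTannoSolution.fderiv_apply_eq_zero [CompactSpace M]
    (hf : g.IsGallotTannoSolution f) (hg : g.IsLightLineComplete)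
    (hφ : φ ∈ IsManifold.maximalAtlas (𝓡 n) ∞ M) {y u : EuclideanSpace ℝ (Fin n)}
    (hy : y ∈ φ.target) (hu : ∑ i, ∑ j, g.comp φ y i j * u i * u j = 0) :
    fderiv ℝ (fun z ↦ f (φ.symm z)) y u = 0 := by
  rcases eq_or_ne u 0 with rfl | hu0
  · simp
  obtain ⟨x, v, hx0, hv0, ε, hε, hxv⟩ := exists_isChartGeodesicAt (g := g) hφ hy hu0
  set J := Set.Ioo (-ε) ε
  set γ : ℝ → M := fun t ↦ φ.symm (x t)
  have hJ : IsOpen J := isOpen_Ioo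
  have h0 : (0 : ℝ) ∈ J := ⟨by linarith, hε⟩
  have hγ : g.IsGeodesicOn γ J := isGeodesicOn_of_isChartGeodesicAt hφ hJ fun t ht ↦ (hxv t ht).1
  have hE0 : g.energy γ 0 = 0 := by
    rw [energy_eq_sum hφ (hxv 0 h0).1.mem .rfl (hxv 0 h0).1.hasDerivAt, hx0, hv0, hu]
  have hE (t : ℝ) (ht : t ∈ J) : g.energy γ t = 0 := by
    rw [← hE0]
    exact hJ.is_const_of_deriv_eq_zero isPreconnected_Ioo
      (fun s hs ↦ (hγ.hasDerivAt_energy hJ hs).differentiableAt.differentiableWithinAt)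
      (fun s hs ↦ (hγ.hasDerivAt_energy hJ hs).deriv) ht h0
  have hlight : g.IsLightLineGeodesicOn γ J := by
    refine ⟨hγ, fun t ht ↦ ⟨fun hvel ↦ (hxv t ht).2 ?_, hE t ht⟩⟩
    have h1 := velocity_eq_mfderiv_chart_symm hφ (hxv t ht).1.mem (γ := γ) .rfl
      (hxv t ht).1.hasDerivAt
    exact mfderiv_chart_symm_injective hφ (hxv t ht).1.mem
      ((h1.symm.trans hvel).trans (map_zero _).symm)
  obtain ⟨γ', hγ', heq⟩ := hg γ J hJ Set.ordConnected_Ioo ⟨0, h0⟩ hlight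
  have hev : γ' =ᶠ[𝓝 0] γ := by
    filter_upwards [hJ.mem_nhds h0] with t ht using heq ht
  have hE' (t : ℝ) : g.energy γ' t = 0 := by
    have h1 : g.energy γ' 0 = 0 := by
      rw [energy_eq_sum hφ (hxv 0 h0).1.mem hev (hxv 0 h0).1.hasDerivAt, hx0, hv0, hu]
    rw [← h1]
    exact is_const_of_deriv_eq_zero
      (fun s ↦ (hγ'.hasDerivAt_energy isOpen_univ (Set.mem_univ s)).differentiableAt)
      (fun s ↦ (hγ'.hasDerivAt_energy isOpen_univ (Set.mem_univ s)).deriv) t 0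
  obtain ⟨C, hC⟩ := isCompact_univ.exists_bound_of_continuousOn hf.1.continuous.continuousOn
  have hd (t : ℝ) := hf.hasDerivAt_comp_geodesic isOpen_univ hγ' (Set.mem_univ t)
  have hzero := deriv_eq_zero_of_bounded_of_third_deriv_eq_zero (fun t ↦ (hd t).1)
    (fun t ↦ (hd t).2.1) (fun t ↦ (hd t).2.2.congr_deriv (by rw [hE' t]; ring))
    (fun t ↦ hC (γ' t) (Set.mem_univ _))
  have hcomp := (hxv 0 h0).1.hasDerivAt_comp (contDiffOn_comp_chart_symm hf.1 hφ)
  have hev' : (fun t ↦ f (γ' t)) =ᶠ[𝓝 0] fun t ↦ f (φ.symm (x t)) :=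
    hev.mono fun t ht ↦ congrArg f ht
  rw [hev'.deriv_eq, hcomp.deriv, hx0, hv0] at hzero
  rw [fderiv_apply_eq_sum_pd]
  exact hzero

/-- The differential of a solution kills all null vectors, and these span the tangent space. -/
theorem IsGallotTannoSolution.fderiv_eq_zero [CompactSpace M] [ConnectedSpace M]
    (hf : g.IsGallotTannoSolution f) (hg : g.IsLightLineComplete) (hind : g.IsIndefinite)
    (hφ : φ ∈ IsManifold.maximalAtlas (𝓡 n) ∞ M) {y : EuclideanSpace ℝ (Fin n)}
    (hy : y ∈ φ.target) : fderiv ℝ (fun z ↦ f (φ.symm z)) y = 0 := by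
  let L : EuclideanSpace ℝ (Fin n) →L[ℝ] EuclideanSpace ℝ (Fin n) →L[ℝ] ℝ := g.form (φ.symm y)
  let D : EuclideanSpace ℝ (Fin n) →L[ℝ] EuclideanSpace ℝ (Fin n) :=
    mfderiv (𝓡 n) (𝓡 n) φ.symm y
  let B : EuclideanSpace ℝ (Fin n) →ₗ[ℝ] EuclideanSpace ℝ (Fin n) →ₗ[ℝ] ℝ :=
    L.toLinearMap₁₂.compl₁₂ D.toLinearMap D.toLinearMap
  obtain ⟨a, ha⟩ := hind.exists_mul_neg (s := -1) (by norm_num) (φ.symm y)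
  obtain ⟨b, hb⟩ := hind.exists_mul_neg (s := 1) one_ne_zero (φ.symm y)
  obtain ⟨a, rfl⟩ := mfderiv_chart_symm_surjective hφ hy a
  obtain ⟨b, rfl⟩ := mfderiv_chart_symm_surjective hφ hy b
  have ha' : 0 < B a a := by rw [neg_one_mul, neg_lt_zero] at ha; exact ha
  have hb' : B b b < 0 := by rw [one_mul] at hb; exact hb
  have h := eq_zero_of_vanish_on_null (B := B) (fun v w ↦ g.symm _ _ _) ha' hb'
    (l := (fderiv ℝ (fun z ↦ f (φ.symm z)) y).toLinearMap) fun u hu ↦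
      hf.fderiv_apply_eq_zero hg hφ hy ((g.form_mfderiv_chart_symm u u).symm.trans hu)
  ext u
  exact LinearMap.congr_fun h u

end Metric

end Main

end PseudoRiem

theorem theorem1 (n : ℕ) {M : Type*} [TopologicalSpace M]
    [ChartedSpace (EuclideanSpace ℝ (Fin n)) M] [IsManifold (𝓡 n) ∞ M]
    [T2Space M] [CompactSpace M] [ConnectedSpace M]
    (g : PseudoRiem.Metric n M) (hindef : g.IsIndefinite) (hcomplete : g.IsLightLineComplete)
    (lam : M → ℝ) (hlam : g.IsGallotTannoSolution lam) :
    ∃ c : ℝ, ∀ x : M, lam x = c := by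
  have hloc : IsLocallyConstant lam := by
    rw [IsLocallyConstant.iff_eventually_eq]
    intro x
    have hφ := IsManifold.chart_mem_maximalAtlas (I := 𝓡 n) (n := ∞) x
    have hx := mem_chart_source (EuclideanSpace ℝ (Fin n)) x
    set φ := chartAt (EuclideanSpace ℝ (Fin n)) x
    have hopen := φ.open_target.isOpen_inter_preimage_of_fderiv_eq_zero
      ((PseudoRiem.contDiffOn_comp_chart_symm hlam.1 hφ).differentiableOn (by simp))
      (fun y hy ↦ hlam.fderiv_eq_zero hcomplete hindef hφ hy) {lam x}
    have hmem : φ x ∈ φ.target ∩ (fun z ↦ lam (φ.symm z)) ⁻¹' {lam x} :=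
      ⟨φ.map_source hx, congrArg lam (φ.left_inv hx)⟩
    filter_upwards [φ.open_source.mem_nhds hx,
      (φ.continuousAt hx).eventually_mem (hopen.mem_nhds hmem)] with z hz hzx
    have := hzx.2
    rwa [Set.mem_preimage, φ.left_inv hz] at this
  obtain ⟨x₀⟩ := (inferInstance : Nonempty M)
  exact ⟨lam x₀, fun x ↦ hloc.apply_eq_of_preconnectedSpace x x₀⟩
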